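/- Let $n\ge 0$, let $z_0,\dots,z_n\in\mathbb D=\{|z|<1\}$ and $w_0,\dots,w_n\in\mathbb C$ be such that the Pick matrix $$P=\Big[\frac{w_k+\bar w_\ell}{1-z_k\bar z_\ell}\Big]_{k,\ell=0}^n$$ is positive definite, and let $K\subset\mathbb D$ be a nonempty set that is closed in $\mathbb C$ (hence compact). A spectrum is a bounded nonnegative Borel measure $d\mu$ on the unit circle. Let $\mathcal F_{\mathbf z,\mathbf w}$ be the set of all spectra $d\mu$ for which the joint output covariance matrix of the bank of filters $G_k(z)=z/(z-z_k)$, $k=0,\dots,n$, is the one determined by $\mathbf w$, in the normalization $$2\cdot\frac1{2\pi}\int_{-\pi}^{\pi}G_k(e^{i\theta})\overline{G_\ell(e^{i\theta})}\,d\mu(\theta)=P_{k\ell},\qquad k,\ell=0,\dots,n .$$ (Equivalently, for some real constant $c$, $\frac1{2\pi}\int\frac{e^{i\theta}+z_k}{e^{i\theta}-z_k}\,d\mu(\theta)=w_k+ic$ for all $k$.) For spectra $d\mu_0,d\mu_1$ put $$\delta_K(d\mu_0,d\mu_1)=\max_{z\in K}\Big|\frac1{2\pi}\int_{-\pi}^{\pi}\frac{1-|z|^2}{|e^{i\theta}-z|^2}\,(d\mu_0-d\mu_1)(\theta)\Big|,$$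 and let $\rho_{\delta_K}(\mathcal F_{\mathbf z,\mathbf w})=\sup\{\delta_K(d\mu_0,d\mu_1): d\mu_0,d\mu_1\in\mathcal F_{\mathbf z,\mathbf w}\}$. Then this supremum is finite and $$\rho_{\delta_K}(\mathcal F_{\mathbf z,\mathbf w})=\max_{z\in K}\left\{2\left(\left|\frac{\frac{1}{1-z\bar z}+\langle b_z,d_z\rangle_{P^{-1}}}{\langle b_z,b_z\rangle_{P^{-1}}}\right|^2-\frac{\langle d_z,d_z\rangle_{P^{-1}}}{\langle b_z,b_z\rangle_{P^{-1}}}\right)^{1/2}\right\},$$ where $b_z=\big(\frac{1}{1-z_k\bar z}\big)_{k=0}^n$, $d_z=-\big(\frac{w_k}{1-z_k\bar z}\big)_{k=0}^n$ and $\langle x,y\rangle_{P^{-1}}=y^*P^{-1}x$; the maximum on the right is attained. Moreover $\rho_{\delta_K}(\mathcal F_{\mathbf z,\mathbf w})$ is attained as the distance $\delta_K(d\mu_0,d\mu_1)$ between two elements of $\mathcal F_{\mathbf z,\mathbf w}$, both singular with respect to Lebesgue measure and each with support containing at most $n+1$ points. -/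

import Mathlib

open MeasureTheory Matrix
open scoped ComplexOrder

noncomputable section

namespace FilterBank

/-- The unit circle, parametrised by the angle `θ` modulo `2π`. -/
abbrev UCircle : Type := AddCircle (2 * Real.pi)

/-- With this instance the measure `volume` on `UCircle` is Lebesgue measure `dθ`
(total mass `2π`). -/
instance factTwoPiPos : Fact (0 < 2 * Real.pi) := ⟨Real.two_pi_pos⟩

/-- A power spectrum: a bounded nonnegative Borel measure on the unit circle. -/
abbrev Spectrum : Type := FiniteMeasure UCircle

/-- The point `e^{iθ}`. -/
def circlePoint (θ : UCircle) : ℂ := (AddCircle.toCircle θ : ℂ)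

/-- The transfer function `G(s) = s / (s - a)` of a first-order filter with pole `a`. -/
def transfer (a s : ℂ) : ℂ := s / (s - a)

/-- The joint covariance matrix `E{u u*}` of the outputs `u₀, …, uₙ` of the filters with poles
`z₀, …, zₙ`, driven by a process with power spectrum `μ`:
its `(k, l)` entry is `(2π)⁻¹ ∫ G_k(e^{iθ}) conj(G_l(e^{iθ})) dμ(θ)`. -/
def outputCovariance {n : ℕ} (z : Fin (n + 1) → ℂ) (μ : Spectrum) :
    Matrix (Fin (n + 1)) (Fin (n + 1)) ℂ :=
  Matrix.of fun k l =>
    (2 * (Real.pi : ℂ))⁻¹ *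
      ∫ θ, transfer (z k) (circlePoint θ) * star (transfer (z l) (circlePoint θ))
        ∂(μ : Measure UCircle)

/-- The Pick matrix with entries `(w_k + conj w_l) / (1 - z_k conj z_l)`. -/
def pickMatrix {n : ℕ} (z w : Fin (n + 1) → ℂ) : Matrix (Fin (n + 1)) (Fin (n + 1)) ℂ :=
  Matrix.of fun k l => (w k + star (w l)) / (1 - z k * star (z l))

/-- The spectra consistent with the filter-bank statistics `w`: those whose output covariance
matrix is the one determined by `w`. The normalisation is the one in which `w_k` is, up to an
imaginary constant common to all `k`, the value at `z_k` of
`(2π)⁻¹ ∫ (e^{iθ} + s) / (e^{iθ} - s) dμ(θ)`; the Pick matrix is then `2 E{u u*}`. -/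
def consistentSpectra {n : ℕ} (z w : Fin (n + 1) → ℂ) : Set Spectrum :=
  {μ | (2 : ℂ) • outputCovariance z μ = pickMatrix z w}

/-- The Poisson integral `(2π)⁻¹ ∫ (1 - |s|²) / |e^{iθ} - s|² dμ(θ)` of a spectrum. -/
def poissonIntegral (μ : Spectrum) (s : ℂ) : ℝ :=
  (2 * Real.pi)⁻¹ * ∫ θ, poissonKernel 0 s (circlePoint θ) ∂(μ : Measure UCircle)

/-- The distance `δ_K`. For a nonempty compact subset `K` of the open unit disc, the supremum is
a maximum. -/
def deltaK (K : Set ℂ) (μ₀ μ₁ : Spectrum) : ℝ :=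
  sSup ((fun s => |poissonIntegral μ₀ s - poissonIntegral μ₁ s|) '' K)

/-- The set of all `δ`-distances between two elements of a family of spectra. -/
def distances (δ : Spectrum → Spectrum → ℝ) (F : Set Spectrum) : Set ℝ :=
  {r | ∃ μ₀ ∈ F, ∃ μ₁ ∈ F, r = δ μ₀ μ₁}

/-- The `δ`-diameter of a family of spectra. -/
def diameter (δ : Spectrum → Spectrum → ℝ) (F : Set Spectrum) : ℝ :=
  sSup (distances δ F)

/-- The vector `b_s`, with entries `1 / (1 - z_k conj s)`. -/
def bVec {n : ℕ} (z : Fin (n + 1) → ℂ) (s : ℂ) : Fin (n + 1) → ℂ :=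
  fun k => 1 / (1 - z k * star s)

/-- The vector `d_s`, with entries `- w_k / (1 - z_k conj s)`. -/
def dVec {n : ℕ} (z w : Fin (n + 1) → ℂ) (s : ℂ) : Fin (n + 1) → ℂ :=
  fun k => -(w k / (1 - z k * star s))

/-- The inner product `⟨x, y⟩ = y* P⁻¹ x`. -/
def innerInv {n : ℕ} (P : Matrix (Fin (n + 1)) (Fin (n + 1)) ℂ) (x y : Fin (n + 1) → ℂ) : ℂ :=
  star y ⬝ᵥ (P⁻¹ *ᵥ x)

/-- The number
`2 (|(1/(1-|s|²) + ⟨b_s,d_s⟩) / ⟨b_s,b_s⟩|² - ⟨d_s,d_s⟩ / ⟨b_s,b_s⟩)^{1/2}`, with the inner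
product given by the inverse of the Pick matrix. The second quotient is real, since the Pick
matrix is Hermitian. -/
def pointwiseDiameter {n : ℕ} (z w : Fin (n + 1) → ℂ) (s : ℂ) : ℝ :=
  2 * Real.sqrt
    (‖(1 / (1 - s * star s) + innerInv (pickMatrix z w) (bVec z s) (dVec z w s)) /
        innerInv (pickMatrix z w) (bVec z s) (bVec z s)‖ ^ 2 -
      (innerInv (pickMatrix z w) (dVec z w s) (dVec z w s) /
        innerInv (pickMatrix z w) (bVec z s) (bVec z s)).re)

/-- The spectrum is singular with respect to Lebesgue measure, and its support contains at most
`m` points. -/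
def IsSingularWithSupportAtMost (m : ℕ) (μ : Spectrum) : Prop :=
  (μ : Measure UCircle) ⟂ₘ volume ∧ (μ : Measure UCircle).support.encard ≤ m

end FilterBank

end

/-! Fix `s` in the disc. A consistent spectrum has a Herglotz transform which, after subtraction of
an imaginary constant, takes the values `w k` at the nodes and some value `ω` at `s`, and its
Poisson integral at `s` is `Re ω`. Adjoining the filter with pole `s` borders the Pick matrix by a
column affine in `star ω`. Covariances are positive semidefinite, so the Schur complement is
nonnegative; completing the square turns this into `ω` lying in a disc with centre `discCenter` and
squared radius `discRadiusSq` (`innerInv_borderVec`, `exists_mem_disc`). Hence two Poisson integrals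
differ by at most the diameter of the disc.

Conversely, for `ω` on the boundary circle the Schur complement vanishes, so the bordered matrix is
the Gram matrix of `n + 2` vectors in an `(n + 1)`-dimensional space. The displacement identity of
Pick matrices yields an isometry of that space, whose spectral decomposition is a measure with `n +
1` atoms realising `ω` (`exists_atoms_of_gram`, `exists_singular_of_boundary`). The two ends of the
horizontal diameter give an extremal pair, and continuity in `s` with compactness of `K` gives the
maximum. -/

noncomputable section

namespace FilterBank

/-! ### Isometries in finite dimension and atomic representation of Gram matrices -/

section InnerProduct

variable {E : Type*} [NormedAddCommGroup E] [InnerProductSpace ℂ E]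

/-- Two finite families with the same Gram matrix are related by an isometry of the space. -/
theorem exists_linearIsometry_apply_eq [FiniteDimensional ℂ E] {ι : Type*} [Fintype ι] (x y : ι → E)
    (h : ∀ k l, inner ℂ (x k) (x l) = inner ℂ (y k) (y l)) :
    ∃ V : E →ₗᵢ[ℂ] E, ∀ k, V (x k) = y k := by
  classical
  let X := Fintype.linearCombination ℂ x
  let Y := Fintype.linearCombination ℂ y
  have hXY : ∀ c, ‖X c‖ = ‖Y c‖ := by
    intro c
    have key : inner ℂ (X c) (X c) = inner ℂ (Y c) (Y c) := by
      simp only [X, Y, Fintype.linearCombination_apply, sum_inner, inner_sum, inner_smul_left,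
        inner_smul_right, h]
    rw [inner_self_eq_norm_sq_to_K, inner_self_eq_norm_sq_to_K] at key
    exact (sq_eq_sq₀ (norm_nonneg _) (norm_nonneg _)).1 (by exact_mod_cast key)
  have hker : LinearMap.ker X ≤ LinearMap.ker Y := by
    intro c hc
    rw [LinearMap.mem_ker] at hc ⊢
    rw [← norm_eq_zero, ← hXY, hc, norm_zero]
  let L₀ : LinearMap.range X →ₗ[ℂ] E :=
    ((LinearMap.ker X).liftQ Y hker) ∘ₗ X.quotKerEquivRange.symm.toLinearMap
  have hL₀ : ∀ c, L₀ ⟨X c, LinearMap.mem_range_self X c⟩ = Y c := by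
    intro c
    simp only [L₀, LinearMap.comp_apply, LinearEquiv.coe_coe]
    rw [LinearMap.quotKerEquivRange_symm_apply_image]
    simp
  let L : LinearMap.range X →ₗᵢ[ℂ] E :=
    { L₀ with
      norm_map' := by
        rintro ⟨_, c, rfl⟩
        exact (congrArg norm (hL₀ c)).trans (hXY c).symm }
  refine ⟨L.extend, fun k => ?_⟩
  have hX : X (Pi.single k 1) = x k := by simp [X]
  have hY : Y (Pi.single k 1) = y k := by simp [Y]
  rw [← hX, ← hY]
  exact (L.extend_apply ⟨X (Pi.single k 1), _⟩).trans (hL₀ _)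

/-- By injectivity and a dimension count an invariant subspace is mapped onto itself, so its
orthogonal complement is invariant too. -/
theorem isSemisimple_linearIsometry [FiniteDimensional ℂ E] (V : E →ₗᵢ[ℂ] E) :
    Module.End.IsSemisimple V.toLinearMap := by
  rw [Module.End.isSemisimple_iff]
  intro p hp
  refine ⟨pᗮ, ?_, p.isCompl_orthogonal⟩
  have hle : p.map V.toLinearMap ≤ p := Submodule.map_le_iff_le_comap.2 hp
  have heq : p.map V.toLinearMap = p := by
    apply Submodule.eq_of_le_of_finrank_eq hle
    exact (p.equivMapOfInjective V.toLinearMap V.injective).finrank_eq.symm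
  intro x hx
  rw [Submodule.mem_comap, Submodule.mem_orthogonal]
  intro u hu
  rw [← heq] at hu
  obtain ⟨v, hv, rfl⟩ := hu
  exact (V.inner_map_map v x).trans ((Submodule.mem_orthogonal _ _).1 hx v hv)

theorem norm_eigenvalue_linearIsometry (V : E →ₗᵢ[ℂ] E)
    (c : Module.End.Eigenvalues V.toLinearMap) : ‖(c : ℂ)‖ = 1 := by
  obtain ⟨v, hv⟩ := Module.End.HasEigenvalue.exists_hasEigenvector c.2
  have h1 : V v = (c : ℂ) • v := hv.apply_eq_smul
  have h2 : ‖V v‖ = ‖v‖ := V.norm_map v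
  rw [h1, norm_smul] at h2
  exact mul_right_cancel₀ (norm_ne_zero_iff.2 hv.2) (h2.trans (one_mul _).symm)

/-- Preservation of the inner product gives `⟪x, y⟫ = conj a * b * ⟪x, y⟫`; as `|a| = 1`, a nonzero
product forces `a = b`. -/
theorem orthogonalFamily_eigenspaces_linearIsometry (V : E →ₗᵢ[ℂ] E) :
    OrthogonalFamily ℂ
      (fun c : Module.End.Eigenvalues V.toLinearMap => Module.End.eigenspace V.toLinearMap c)
      fun c => (Module.End.eigenspace V.toLinearMap c).subtypeₗᵢ := by
  rintro a b hab ⟨x, hx⟩ ⟨y, hy⟩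
  rw [Module.End.mem_eigenspace_iff] at hx hy
  change inner ℂ x y = 0
  have hx' : V x = (a : ℂ) • x := hx
  have hy' : V y = (b : ℂ) • y := hy
  have h := V.inner_map_map x y
  rw [hx', hy', inner_smul_left, inner_smul_right] at h
  by_contra hne
  apply hab
  have h1 : (starRingEnd ℂ) (a : ℂ) * b = 1 := by
    apply mul_right_cancel₀ hne
    rw [mul_assoc, h, one_mul]
  have h2 : (a : ℂ) * (starRingEnd ℂ) (a : ℂ) = 1 := by
    rw [Complex.mul_conj, Complex.normSq_eq_norm_sq, norm_eigenvalue_linearIsometry]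
    simp
  apply Subtype.ext
  calc (a : ℂ) = a * ((starRingEnd ℂ) (a : ℂ) * b) := by rw [h1, mul_one]
    _ = b := by rw [← mul_assoc, h2, one_mul]

/-- The spectral theorem for isometries of a finite-dimensional complex inner product space. -/
theorem exists_orthonormalBasis_eigenvectors [FiniteDimensional ℂ E] (V : E →ₗᵢ[ℂ] E) {m : ℕ}
    (hm : Module.finrank ℂ E = m) :
    ∃ (u : OrthonormalBasis (Fin m) ℂ E) (c : Fin m → ℂ),
      (∀ j, ‖c j‖ = 1) ∧ ∀ j, V (u j) = c j • u j := by
  classical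
  have hfam := orthogonalFamily_eigenspaces_linearIsometry V
  have hint : DirectSum.IsInternal fun c : Module.End.Eigenvalues V.toLinearMap =>
      Module.End.eigenspace V.toLinearMap c := by
    rw [hfam.isInternal_iff]
    have h := (isSemisimple_linearIsometry V).iSup_eigenspace_eq_top
    have h' : (⨆ c : Module.End.Eigenvalues V.toLinearMap,
        Module.End.eigenspace V.toLinearMap c) = ⊤ := by
      rw [eq_top_iff, ← h]
      refine iSup_le fun c => ?_
      by_cases hc : Module.End.eigenspace V.toLinearMap c = ⊥
      · rw [hc]; exact bot_le
      · exact le_iSup (fun c : Module.End.Eigenvalues V.toLinearMap =>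
          Module.End.eigenspace V.toLinearMap c) ⟨c, hc⟩
    rw [h', Submodule.top_orthogonal_eq_bot]
  let idx : Fin m → Module.End.Eigenvalues V.toLinearMap :=
    fun j => hint.subordinateOrthonormalBasisIndex hm j hfam
  refine ⟨hint.subordinateOrthonormalBasis hm hfam, fun j => (idx j : ℂ),
    fun j => norm_eigenvalue_linearIsometry V _, fun j => ?_⟩
  exact Module.End.mem_eigenspace_iff.1 (hint.subordinateOrthonormalBasis_subordinate hm j hfam)

theorem exists_circlePoint_eq {c : ℂ} (hc : ‖c‖ = 1) : ∃ θ : UCircle, circlePoint θ = c := by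
  obtain ⟨θ, hθ⟩ := (AddCircle.homeomorphCircle (T := 2 * Real.pi) Real.two_pi_pos.ne').surjective
    ⟨c, mem_sphere_zero_iff_norm.2 hc⟩
  rw [AddCircle.homeomorphCircle_apply] at hθ
  exact ⟨θ, by rw [circlePoint, hθ]⟩

theorem circlePoint_mul_star (θ : UCircle) : circlePoint θ * star (circlePoint θ) = 1 := by
  have h : ‖circlePoint θ‖ = 1 := Circle.norm_coe _
  rw [Complex.star_def, Complex.mul_conj, Complex.normSq_eq_norm_sq, h]
  simp

theorem one_sub_mul_ne_zero {a b : ℂ} (ha : ‖a‖ < 1) (hb : ‖b‖ ≤ 1) : 1 - a * b ≠ 0 := by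
  intro h
  have h1 : ‖a * b‖ = 1 := by rw [← sub_eq_zero.1 h, norm_one]
  rw [norm_mul] at h1
  nlinarith [norm_nonneg a, norm_nonneg b]

theorem transfer_circlePoint (a : ℂ) (θ : UCircle) :
    transfer a (circlePoint θ) = (1 - a * star (circlePoint θ))⁻¹ := by
  have h := circlePoint_mul_star θ
  have h0 : circlePoint θ ≠ 0 := by
    intro h0
    simp [h0] at h
  have h2 : circlePoint θ - a = circlePoint θ * (1 - a * star (circlePoint θ)) := by
    linear_combination a * h
  rw [transfer, h2, div_mul_eq_div_div, div_self h0, one_div]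

/-- A Gram matrix of Pick type is the Gram matrix of first-order filters with respect to a
measure on the circle with as many atoms as the dimension of the space. -/
theorem exists_atoms_of_gram [FiniteDimensional ℂ E] {ι : Type*} [Fintype ι] [Nonempty ι] (a c : ι → ℂ) (g : ι → E)
    (ha : ∀ k, ‖a k‖ < 1)
    (hg : ∀ k l, (1 - a k * star (a l)) * inner ℂ (g l) (g k) = c k + star (c l))
    {m : ℕ} (hm : Module.finrank ℂ E = m) :
    ∃ (θ : Fin m → UCircle) (r : Fin m → NNReal), ∀ k l,
      inner ℂ (g l) (g k) = ∑ j, (r j : ℂ) *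
        (transfer (a k) (circlePoint (θ j)) * star (transfer (a l) (circlePoint (θ j)))) := by
  obtain ⟨o⟩ := ‹Nonempty ι›
  -- Lurking isometry: subtracting the vector of a base index `o` cancels the terms `c k + star (c
  -- l)`, so both families of differences have equal Gram matrices.
  obtain ⟨V, hV⟩ := exists_linearIsometry_apply_eq (fun k => a k • g k - a o • g o)
    (fun k => g k - g o) (by
      intro l k
      simp only [inner_sub_left, inner_sub_right, inner_smul_left, inner_smul_right]
      have h1 := hg k l
      have h2 := hg k o
      have h3 := hg o l
      have h4 := hg o o
      simp only [Complex.star_def] at h1 h2 h3 h4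
      linear_combination -h1 + h2 + h3 - h4)
  obtain ⟨u, b, hb, hu⟩ := exists_orthonormalBasis_eigenvectors V hm
  have hbb : ∀ j, (starRingEnd ℂ) (b j) * b j = 1 := by
    intro j
    rw [mul_comm, Complex.mul_conj, Complex.normSq_eq_norm_sq, hb]
    simp
  -- The atom sits at the conjugate eigenvalue because on the circle the transfer function is `1 /
  -- (1 - a * conj e^{iθ})`.
  choose θ hθ using fun j => exists_circlePoint_eq (c := star (b j)) (by rw [norm_star, hb])
  have hinner : ∀ j x, inner ℂ (u j) (V x) = b j * inner ℂ (u j) x := by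
    intro j x
    have h := V.inner_map_map (u j) x
    rw [hu, inner_smul_left] at h
    rw [← h, ← mul_assoc, mul_comm (b j), hbb, one_mul]
  -- The relation defining `V` says that `g k - a k • V (g k)` does not depend on `k`; in
  -- eigencoordinates this makes `g k` the transfer function times the coordinate of `e`.
  let e : E := g o - a o • V (g o)
  have he : ∀ k, g k - a k • V (g k) = e := by
    intro k
    have h := hV k
    simp only [map_sub, map_smul] at h
    have h' : g k - a k • V (g k) - (g o - a o • V (g o)) =
        (g k - g o) - (a k • V (g k) - a o • V (g o)) := by abel
    rw [h, sub_self] at h'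
    exact sub_eq_zero.1 h'
  have hcoord : ∀ j k, inner ℂ (u j) (g k) =
      transfer (a k) (circlePoint (θ j)) * inner ℂ (u j) e := by
    intro j k
    have hne : 1 - a k * b j ≠ 0 := one_sub_mul_ne_zero (ha k) (hb j).le
    rw [transfer_circlePoint, hθ, star_star, ← he k, inner_sub_right, inner_smul_right, hinner]
    field_simp
  refine ⟨θ, fun j => ‖(inner ℂ (u j) e : ℂ)‖₊ ^ 2, fun k l => ?_⟩
  rw [← u.sum_inner_mul_inner]
  refine Finset.sum_congr rfl fun j _ => ?_
  rw [← inner_conj_symm (g l) (u j), hcoord, hcoord, map_mul]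
  have hsq : ((‖(inner ℂ (u j) e : ℂ)‖₊ ^ 2 : NNReal) : ℂ) =
      (starRingEnd ℂ) (inner ℂ (u j) e) * inner ℂ (u j) e := by
    rw [mul_comm, Complex.mul_conj, Complex.normSq_eq_norm_sq]
    simp
  rw [hsq, Complex.star_def]
  ring

end InnerProduct

/-! ### Atomic spectra -/

/-- The finitely supported measure with atoms of mass `π r_j` at the points `θ_j`. -/
def atomicSpectrum {m : ℕ} (θ : Fin m → UCircle) (r : Fin m → NNReal) : Spectrum :=
  ⟨∑ j, (NNReal.pi * r j) • Measure.dirac (θ j), inferInstance⟩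

theorem integral_atomicSpectrum {F : Type*} [NormedAddCommGroup F] [NormedSpace ℝ F]
    [CompleteSpace F] {m : ℕ} (θ : Fin m → UCircle)
    (r : Fin m → NNReal) (f : UCircle → F) :
    ∫ t, f t ∂(atomicSpectrum θ r : Measure UCircle) = ∑ j, (Real.pi * r j) • f (θ j) := by
  change ∫ t, f t ∂(∑ j, (NNReal.pi * r j) • Measure.dirac (θ j)) = _
  rw [integral_finsetSum_measure]
  · refine Finset.sum_congr rfl fun j _ => ?_
    rw [integral_smul_nnreal_measure, integral_dirac]
    rfl
  · intro j _
    exact (integrable_dirac (by simp)).smul_measure_nnreal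

theorem volume_singleton_eq_zero (t : UCircle) : (volume : Measure UCircle) {t} = 0 := by
  rw [← Metric.closedBall_zero, AddCircle.volume_closedBall]
  simp [Real.pi_pos.le]

theorem atomicSpectrum_singular {m : ℕ} (θ : Fin m → UCircle) (r : Fin m → NNReal) :
    IsSingularWithSupportAtMost m (atomicSpectrum θ r) := by
  have hfin : (Set.range θ).Finite := Set.finite_range θ
  have hnull : (atomicSpectrum θ r : Measure UCircle) (Set.range θ)ᶜ = 0 := by
    change (∑ j, (NNReal.pi * r j) • Measure.dirac (θ j) : Measure UCircle) _ = 0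
    simp [Measure.finsetSum_apply, hfin.measurableSet]
  constructor
  · refine ⟨(Set.range θ)ᶜ, hfin.measurableSet.compl, hnull, ?_⟩
    rw [compl_compl]
    exact (measure_null_iff_singleton hfin.countable).2 fun t _ => volume_singleton_eq_zero t
  · calc (atomicSpectrum θ r : Measure UCircle).support.encard ≤ (Set.range θ).encard :=
          Set.encard_le_encard (Measure.support_subset_of_isClosed hfin.isClosed
            (mem_ae_iff.2 hnull))
      _ ≤ m := by
          rw [← Set.image_univ]
          exact (Set.encard_image_le _ _).trans (by simp)

/-! ### Covariances, the Herglotz transform and the Poisson integral -/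

/-- Twice the cross-covariance of the outputs of the filters with poles `a` and `b`. -/
def crossCovariance (μ : Spectrum) (a b : ℂ) : ℂ :=
  2 * ((2 * (Real.pi : ℂ))⁻¹ *
    ∫ θ, transfer a (circlePoint θ) * star (transfer b (circlePoint θ)) ∂(μ : Measure UCircle))

/-- The Herglotz transform `(2π)⁻¹ ∫ (e^{iθ} + s) / (e^{iθ} - s) dμ(θ)`, the kernel being
written as `2 G_s - 1`. -/
def herglotz (μ : Spectrum) (s : ℂ) : ℂ :=
  (2 * (Real.pi : ℂ))⁻¹ * ∫ θ, (2 * transfer s (circlePoint θ) - 1) ∂(μ : Measure UCircle)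

theorem norm_circlePoint (θ : UCircle) : ‖circlePoint θ‖ = 1 := Circle.norm_coe _

theorem continuous_circlePoint : Continuous circlePoint :=
  continuous_subtype_val.comp AddCircle.continuous_toCircle

theorem one_sub_mul_star_circlePoint_ne_zero {a : ℂ} (ha : ‖a‖ < 1) (θ : UCircle) :
    1 - a * star (circlePoint θ) ≠ 0 :=
  one_sub_mul_ne_zero ha (by rw [norm_star, norm_circlePoint])

theorem continuous_transfer_circlePoint {a : ℂ} (ha : ‖a‖ < 1) :
    Continuous fun θ => transfer a (circlePoint θ) := by
  simp only [transfer_circlePoint]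
  exact (continuous_const.sub (continuous_const.mul continuous_circlePoint.star)).inv₀
    (one_sub_mul_star_circlePoint_ne_zero ha)

theorem integrable_of_continuous (μ : Spectrum) {f : UCircle → ℂ} (hf : Continuous f) :
    Integrable f (μ : Measure UCircle) :=
  hf.integrable_of_hasCompactSupport (HasCompactSupport.of_compactSpace _)

/-- On the circle, `(2 G_a - 1) + conj (2 G_b - 1) = 2 (1 - a * conj b) G_a * conj G_b`; integrate.
-/
theorem one_sub_mul_crossCovariance (μ : Spectrum) {a b : ℂ} (ha : ‖a‖ < 1) (hb : ‖b‖ < 1) :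
    (1 - a * star b) * crossCovariance μ a b = herglotz μ a + star (herglotz μ b) := by
  have hca := continuous_transfer_circlePoint ha
  have hcb := continuous_transfer_circlePoint hb
  have hstar : star (herglotz μ b) = (2 * (Real.pi : ℂ))⁻¹ *
      ∫ θ, star (2 * transfer b (circlePoint θ) - 1) ∂(μ : Measure UCircle) := by
    simp only [herglotz, Complex.star_def, map_mul, integral_conj]
    simp [map_ofNat]
  rw [hstar, herglotz, crossCovariance, ← mul_add, ← integral_add]
  · have hpt : ∀ θ : UCircle, 2 * transfer a (circlePoint θ) - 1 +
        star (2 * transfer b (circlePoint θ) - 1) = (2 * (1 - a * star b)) *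
          (transfer a (circlePoint θ) * star (transfer b (circlePoint θ))) := by
      intro θ
      have h1 := one_sub_mul_star_circlePoint_ne_zero ha θ
      have h2 : 1 - star b * circlePoint θ ≠ 0 :=
        one_sub_mul_ne_zero (by rwa [norm_star]) (norm_circlePoint θ).le
      have h3 := circlePoint_mul_star θ
      simp only [transfer_circlePoint, star_sub, star_mul', star_inv₀, star_one, star_star,
        star_ofNat]
      field_simp
      linear_combination (-2 * a * star b) * h3
    simp only [hpt, integral_const_mul]
    ring
  · exact integrable_of_continuous μ ((continuous_const.mul hca).sub continuous_const)
  · exact integrable_of_continuous μ ((continuous_const.mul hcb).sub continuous_const).star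

theorem mem_consistentSpectra_iff {n : ℕ} {z w : Fin (n + 1) → ℂ} {μ : Spectrum} :
    μ ∈ consistentSpectra z w ↔ ∀ k l, crossCovariance μ (z k) (z l) = pickMatrix z w k l := by
  rw [consistentSpectra, Set.mem_ofPred_eq, ← Matrix.ext_iff]
  rfl

/-- The Poisson kernel at `s` is `(1 - |s|²) |G_s|²` on the circle. -/
theorem two_mul_poissonIntegral (μ : Spectrum) {s : ℂ} (hs : ‖s‖ < 1) :
    (2 * poissonIntegral μ s : ℂ) = (1 - s * star s) * crossCovariance μ s s := by
  have hpt : ∀ θ : UCircle, ((poissonKernel 0 s (circlePoint θ) : ℝ) : ℂ) =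
      (1 - s * star s) * (transfer s (circlePoint θ) * star (transfer s (circlePoint θ))) := by
    intro θ
    have h3 := circlePoint_mul_star θ
    have h1 := one_sub_mul_star_circlePoint_ne_zero hs θ
    have h2 : 1 - star s * circlePoint θ ≠ 0 :=
      one_sub_mul_ne_zero (by rwa [norm_star]) (norm_circlePoint θ).le
    have h4 : ((‖circlePoint θ - s‖ ^ 2 : ℝ) : ℂ) =
        (1 - s * star (circlePoint θ)) * (1 - star s * circlePoint θ) := by
      rw [← Complex.normSq_eq_norm_sq, ← Complex.mul_conj, ← Complex.star_def, star_sub]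
      linear_combination (1 - s * star s) * h3
    have h5 : ((‖s‖ ^ 2 : ℝ) : ℂ) = s * star s := by
      rw [← Complex.normSq_eq_norm_sq, ← Complex.mul_conj, Complex.star_def]
    rw [poissonKernel_def, Complex.ofReal_div]
    simp only [sub_zero]
    rw [h4, norm_circlePoint, one_pow, Complex.ofReal_sub, h5]
    simp only [transfer_circlePoint, star_sub, star_mul', star_inv₀, star_one, star_star]
    rw [Complex.ofReal_one]
    field_simp
  rw [crossCovariance, poissonIntegral, Complex.ofReal_mul, ← integral_complex_ofReal]
  simp only [hpt, integral_const_mul]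
  push_cast
  ring

theorem star_crossCovariance (μ : Spectrum) (a b : ℂ) :
    star (crossCovariance μ a b) = crossCovariance μ b a := by
  have h : star (∫ θ, transfer a (circlePoint θ) * star (transfer b (circlePoint θ))
      ∂(μ : Measure UCircle)) =
      ∫ θ, transfer b (circlePoint θ) * star (transfer a (circlePoint θ))
        ∂(μ : Measure UCircle) := by
    rw [Complex.star_def, ← integral_conj]
    simp [mul_comm]
  rw [crossCovariance, star_mul', star_mul', h]
  simp [crossCovariance]

/-- The quadratic form at `x` is a positive multiple of the integral of `|∑ conj (x k) G_k|²`. -/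
theorem posSemidef_crossCovariance (μ : Spectrum) {ι : Type*} [Fintype ι] (a : ι → ℂ)
    (ha : ∀ k, ‖a k‖ < 1) :
    (Matrix.of fun k l => crossCovariance μ (a k) (a l)).PosSemidef := by
  refine Matrix.PosSemidef.of_dotProduct_mulVec_nonneg ?_ fun x => ?_
  · ext k l
    exact star_crossCovariance μ _ _
  · have hc : ∀ k, Continuous fun θ => transfer (a k) (circlePoint θ) :=
      fun k => continuous_transfer_circlePoint (ha k)
    have key : star x ⬝ᵥ (Matrix.of fun k l => crossCovariance μ (a k) (a l)) *ᵥ x =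
        2 * ((2 * (Real.pi : ℂ))⁻¹ * ∫ θ, ((‖∑ k, star (x k) * transfer (a k) (circlePoint θ)‖ ^ 2 :
          ℝ) : ℂ) ∂(μ : Measure UCircle)) := by
      have hpt : ∀ θ, ((‖∑ k, star (x k) * transfer (a k) (circlePoint θ)‖ ^ 2 : ℝ) : ℂ) =
          ∑ k, ∑ l, (star (x k) * x l) *
            (transfer (a k) (circlePoint θ) * star (transfer (a l) (circlePoint θ))) := by
        intro θ
        rw [← Complex.normSq_eq_norm_sq, ← Complex.mul_conj, ← Complex.star_def, star_sum,
          Finset.sum_mul_sum]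
        refine Finset.sum_congr rfl fun k _ => Finset.sum_congr rfl fun l _ => ?_
        rw [star_mul', star_star]
        ring
      have hint : ∀ k l, Integrable (fun θ => (star (x k) * x l) *
            (transfer (a k) (circlePoint θ) * star (transfer (a l) (circlePoint θ))))
            (μ : Measure UCircle) := fun k l =>
        integrable_of_continuous μ (continuous_const.mul ((hc k).mul (hc l).star))
      simp only [hpt]
      rw [integral_finsetSum _ fun k _ => integrable_finsetSum _ fun l _ => hint k l]
      simp only [integral_finsetSum _ fun l _ => hint _ l, integral_const_mul, dotProduct,
        Matrix.mulVec, Matrix.of_apply, Finset.mul_sum, crossCovariance, Pi.star_apply]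
      refine Finset.sum_congr rfl fun k _ => Finset.sum_congr rfl fun l _ => ?_
      ring
    rw [key, integral_complex_ofReal]
    have h0 : 0 ≤ 2 * ((2 * Real.pi)⁻¹ *
        ∫ θ, ‖∑ k, star (x k) * transfer (a k) (circlePoint θ)‖ ^ 2 ∂(μ : Measure UCircle)) := by
      have := integral_nonneg (μ := (μ : Measure UCircle))
        (f := fun θ => ‖∑ k, star (x k) * transfer (a k) (circlePoint θ)‖ ^ 2)
        (fun θ => by positivity)
      positivity
    exact_mod_cast h0

/-- The masses `π r_j` absorb the prefactor `2 (2π)⁻¹`. -/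
theorem crossCovariance_atomicSpectrum {m : ℕ} (θ : Fin m → UCircle) (r : Fin m → NNReal)
    (a b : ℂ) :
    crossCovariance (atomicSpectrum θ r) a b = ∑ j, (r j : ℂ) *
      (transfer a (circlePoint (θ j)) * star (transfer b (circlePoint (θ j)))) := by
  rw [crossCovariance, integral_atomicSpectrum, Finset.mul_sum, Finset.mul_sum]
  refine Finset.sum_congr rfl fun j _ => ?_
  have hpi : (Real.pi : ℂ) ≠ 0 := by exact_mod_cast Real.pi_ne_zero
  rw [Complex.real_smul]
  push_cast
  field_simp

/-- Up to a common imaginary constant, the Herglotz transform of a consistent spectrum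
interpolates the data. -/
theorem exists_interpolation_value {n : ℕ} {z w : Fin (n + 1) → ℂ} (hz : ∀ k, ‖z k‖ < 1)
    {μ : Spectrum} (hμ : μ ∈ consistentSpectra z w) {s : ℂ} (hs : ‖s‖ < 1) :
    ∃ ω : ℂ, (1 - s * star s) * crossCovariance μ s s = ω + star ω ∧
      ∀ k, (1 - z k * star s) * crossCovariance μ (z k) s = w k + star ω := by
  have hdata : ∀ k l, herglotz μ (z k) + star (herglotz μ (z l)) = w k + star (w l) := by
    intro k l
    have hne : 1 - z k * star (z l) ≠ 0 :=
      one_sub_mul_ne_zero (hz k) (by rw [norm_star]; exact (hz l).le)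
    rw [← one_sub_mul_crossCovariance μ (hz k) (hz l), mem_consistentSpectra_iff.1 hμ]
    simp only [pickMatrix, Matrix.of_apply]
    field_simp
  -- By `hdata`, all differences `herglotz μ (z k) - w k` equal one imaginary constant, which is
  -- removed here.
  refine ⟨herglotz μ s - (herglotz μ (z 0) - w 0), ?_, fun k => ?_⟩
  · rw [one_sub_mul_crossCovariance μ hs hs, star_sub, star_sub]
    linear_combination hdata 0 0
  · rw [one_sub_mul_crossCovariance μ (hz k) hs, star_sub, star_sub]
    linear_combination hdata k 0

/-! ### The inner product of the inverse Pick matrix -/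

section InnerInv

variable {n : ℕ} {P : Matrix (Fin (n + 1)) (Fin (n + 1)) ℂ}

theorem star_innerInv (hP : P.PosDef) (x y : Fin (n + 1) → ℂ) :
    star (innerInv P x y) = innerInv P y x := by
  rw [innerInv, innerInv, ← star_dotProduct_star, star_star, star_mulVec, hP.isHermitian.inv.eq,
    dotProduct_comm, dotProduct_mulVec, dotProduct_comm]

theorem ofReal_re_innerInv_self (hP : P.PosDef) (x : Fin (n + 1) → ℂ) :
    ((innerInv P x x).re : ℂ) = innerInv P x x :=
  Complex.conj_eq_iff_re.1 (star_innerInv hP x x)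

theorem innerInv_self_re_pos (hP : P.PosDef) {x : Fin (n + 1) → ℂ} (hx : x ≠ 0) :
    0 < (innerInv P x x).re :=
  (Complex.pos_iff.1 (hP.inv.dotProduct_mulVec_pos hx)).1

theorem innerInv_star_smul_sub (P : Matrix (Fin (n + 1)) (Fin (n + 1)) ℂ) (ω : ℂ)
    (x y : Fin (n + 1) → ℂ) :
    innerInv P (star ω • x - y) (star ω • x - y) =
      ω * star ω * innerInv P x x - ω * innerInv P y x - star ω * innerInv P x y +
        innerInv P y y := by
  simp only [innerInv, star_sub, star_smul, star_star, mulVec_sub, mulVec_smul, sub_dotProduct,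
    dotProduct_sub, smul_dotProduct, dotProduct_smul, smul_eq_mul]
  ring

/-- The Schur complement bound for a matrix with positive definite leading block. -/
theorem innerInv_le_of_posSemidef (hP : P.PosDef) {p : Fin (n + 1) → ℂ} {q : ℂ}
    (h : (Matrix.fromBlocks P (Matrix.replicateCol Unit p) (Matrix.replicateCol Unit p)ᴴ
      (Matrix.of fun _ _ : Unit => q)).PosSemidef) : (innerInv P p p).re ≤ q.re := by
  have := hP.isUnit.invertible
  have h1 := (Matrix.PosDef.fromBlocks₁₁ _ _ hP).1 h
  have h2 := h1.diag_nonneg (i := ())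
  have h3 : ((Matrix.replicateCol Unit p)ᴴ * P⁻¹ * Matrix.replicateCol Unit p) () () =
      innerInv P p p := by
    rw [Matrix.mul_assoc]
    rfl
  rw [Matrix.sub_apply, h3] at h2
  have h4 := (Complex.nonneg_iff.1 h2).1
  simpa using h4

end InnerInv

/-! ### The disc of interpolation values and its extremal spectra -/

section Disc

variable {n : ℕ} (z w : Fin (n + 1) → ℂ) (s : ℂ)

/-- The centre of the disc of values at `s` of the interpolants. -/
def discCenter : ℂ :=
  (1 / (1 - s * star s) + innerInv (pickMatrix z w) (bVec z s) (dVec z w s)) /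
    innerInv (pickMatrix z w) (bVec z s) (bVec z s)

/-- The squared radius of the disc of values at `s` of the interpolants. -/
def discRadiusSq : ℝ :=
  ‖discCenter z w s‖ ^ 2 - (innerInv (pickMatrix z w) (dVec z w s) (dVec z w s) /
    innerInv (pickMatrix z w) (bVec z s) (bVec z s)).re

/-- The column by which the Pick matrix is bordered when the value `ω` at `s` is added. -/
def borderVec (ω : ℂ) : Fin (n + 1) → ℂ := star ω • bVec z s - dVec z w s

theorem pointwiseDiameter_eq :
    pointwiseDiameter z w s = 2 * Real.sqrt (discRadiusSq z w s) := rfl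

variable {z w s}

theorem bVec_ne_zero (hz : ∀ k, ‖z k‖ < 1) (hs : ‖s‖ < 1) : bVec z s ≠ 0 := by
  intro h
  have h0 := congrFun h 0
  simp only [bVec, Pi.zero_apply] at h0
  exact one_div_ne_zero (one_sub_mul_ne_zero (hz 0) (by rw [norm_star]; exact hs.le)) h0

theorem one_sub_mul_borderVec (hz : ∀ k, ‖z k‖ < 1) (hs : ‖s‖ < 1) (ω : ℂ) (k : Fin (n + 1)) :
    (1 - z k * star s) * borderVec z w s ω k = w k + star ω := by
  have hne : 1 - z k * star s ≠ 0 := one_sub_mul_ne_zero (hz k) (by rw [norm_star]; exact hs.le)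
  simp only [borderVec, bVec, dVec, Pi.sub_apply, Pi.smul_apply, smul_eq_mul]
  field_simp
  ring

/-- The defect of the bordered Pick matrix as the power of the point `ω` with respect to the
boundary of the disc. -/
theorem innerInv_borderVec (hP : (pickMatrix z w).PosDef) (hz : ∀ k, ‖z k‖ < 1) (hs : ‖s‖ < 1)
    (ω : ℂ) :
    innerInv (pickMatrix z w) (borderVec z w s ω) (borderVec z w s ω) -
        (ω + star ω) / (1 - s * star s) =
      innerInv (pickMatrix z w) (bVec z s) (bVec z s) *
        ((‖ω - discCenter z w s‖ ^ 2 - discRadiusSq z w s : ℝ) : ℂ) := by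
  have hB : innerInv (pickMatrix z w) (bVec z s) (bVec z s) ≠ 0 := by
    intro h
    have := innerInv_self_re_pos hP (bVec_ne_zero hz hs)
    rw [h] at this
    exact lt_irrefl _ this
  have hne : 1 - s * star s ≠ 0 := one_sub_mul_ne_zero hs (by rw [norm_star]; exact hs.le)
  have hnorm : ∀ x : ℂ, ((‖x‖ ^ 2 : ℝ) : ℂ) = x * star x := fun x => by
    rw [← Complex.normSq_eq_norm_sq, ← Complex.mul_conj, Complex.star_def]
  have hD : (((innerInv (pickMatrix z w) (dVec z w s) (dVec z w s) /
      innerInv (pickMatrix z w) (bVec z s) (bVec z s)).re : ℝ) : ℂ) =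
      innerInv (pickMatrix z w) (dVec z w s) (dVec z w s) /
      innerInv (pickMatrix z w) (bVec z s) (bVec z s) := by
    rw [← ofReal_re_innerInv_self hP (dVec z w s), ← ofReal_re_innerInv_self hP (bVec z s),
      ← Complex.ofReal_div, Complex.ofReal_re]
  have hstar : star (discCenter z w s) =
      (1 / (1 - s * star s) + innerInv (pickMatrix z w) (dVec z w s) (bVec z s)) /
        innerInv (pickMatrix z w) (bVec z s) (bVec z s) := by
    simp only [discCenter, star_div₀, star_add, star_innerInv hP, star_one, star_sub, star_mul',
      star_star, mul_comm (star s)]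
  -- The left side is a real quadratic in `ω` with leading coefficient `⟨b, b⟩`; what remains is
  -- completing the square.
  rw [borderVec, innerInv_star_smul_sub, discRadiusSq]
  simp only [Complex.ofReal_sub, hD, hnorm, star_sub, hstar]
  rw [discCenter]
  field_simp
  ring

/-- The value at `s` of the Herglotz transform of a consistent spectrum lies in the disc. -/
theorem exists_mem_disc (hP : (pickMatrix z w).PosDef) (hz : ∀ k, ‖z k‖ < 1) (hs : ‖s‖ < 1)
    {μ : Spectrum} (hμ : μ ∈ consistentSpectra z w) :
    ∃ ω : ℂ, ω.re = poissonIntegral μ s ∧ ‖ω - discCenter z w s‖ ^ 2 ≤ discRadiusSq z w s := by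
  obtain ⟨ω, h1, h2⟩ := exists_interpolation_value hz hμ hs
  have hne : 1 - s * star s ≠ 0 := one_sub_mul_ne_zero hs (by rw [norm_star]; exact hs.le)
  refine ⟨ω, ?_, ?_⟩
  · have h3 := two_mul_poissonIntegral μ hs
    rw [h1] at h3
    have h4 := congrArg Complex.re h3
    simp at h4
    linarith
  · have hq : crossCovariance μ s s = (ω + star ω) / (1 - s * star s) := by
      rw [← h1]
      field_simp
    have hp : ∀ k, crossCovariance μ (z k) s = borderVec z w s ω k := fun k =>
      mul_left_cancel₀ (one_sub_mul_ne_zero (hz k) (by rw [norm_star]; exact hs.le))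
        ((h2 k).trans (one_sub_mul_borderVec hz hs ω k).symm)
    have hpsd := posSemidef_crossCovariance μ (Sum.elim z fun _ : Unit => s)
      (by rintro (k | k) <;> simp [hz, hs])
    have hblock : (Matrix.of fun k l => crossCovariance μ (Sum.elim z (fun _ : Unit => s) k)
        (Sum.elim z (fun _ : Unit => s) l)) =
        Matrix.fromBlocks (pickMatrix z w) (Matrix.replicateCol Unit (borderVec z w s ω))
          (Matrix.replicateCol Unit (borderVec z w s ω))ᴴ
          (Matrix.of fun _ _ : Unit => crossCovariance μ s s) := by
      ext (k | k) (l | l)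
      · simp [mem_consistentSpectra_iff.1 hμ]
      · simp [hp]
      · simp [← hp, ← star_crossCovariance μ (z l) s]
      · simp
    -- The covariance matrix for the poles `z` and `s` is the bordered Pick matrix; a point outside
    -- the disc would violate its Schur complement bound.
    rw [hblock] at hpsd
    have hle := innerInv_le_of_posSemidef hP hpsd
    have h5 := congrArg Complex.re (innerInv_borderVec hP hz hs ω)
    rw [← hq, Complex.sub_re, Complex.re_mul_ofReal] at h5
    have hBpos := innerInv_self_re_pos hP (bVec_ne_zero (z := z) hz hs)
    by_contra! hlt
    have := mul_pos hBpos (sub_pos.2 hlt)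
    linarith

/-- Each boundary point of the disc is the value of a consistent spectrum with few atoms. -/
theorem exists_singular_of_boundary (hP : (pickMatrix z w).PosDef) (hz : ∀ k, ‖z k‖ < 1)
    (hs : ‖s‖ < 1) {ω : ℂ} (hω : ‖ω - discCenter z w s‖ ^ 2 = discRadiusSq z w s) :
    ∃ μ ∈ consistentSpectra z w, IsSingularWithSupportAtMost (n + 1) μ ∧
      poissonIntegral μ s = ω.re := by
  classical
  have hne : 1 - s * star s ≠ 0 := one_sub_mul_ne_zero hs (by rw [norm_star]; exact hs.le)
  -- On the circle the Schur complement is zero, so bordering does not raise the rank and no extra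
  -- dimension is needed below.
  have hnorm : innerInv (pickMatrix z w) (borderVec z w s ω) (borderVec z w s ω) =
      (ω + star ω) / (1 - s * star s) := by
    have h := innerInv_borderVec hP hz hs ω
    rw [hω, sub_self, Complex.ofReal_zero, mul_zero] at h
    exact sub_eq_zero.1 h
  obtain ⟨A, hA⟩ : ∃ A : Matrix (Fin (n + 1)) (Fin (n + 1)) ℂ, pickMatrix z w = A * Aᴴ := by
    open scoped MatrixOrder in
    obtain ⟨C, hC⟩ := CStarAlgebra.nonneg_iff_eq_star_mul_self.1 hP.posSemidef.nonneg
    exact ⟨Cᴴ, by rw [hC, conjTranspose_conjTranspose]; rfl⟩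
  set p := borderVec z w s ω with hp
  -- The rows of `A` have Gram matrix `P`; the combination with coefficients `star (P⁻¹ p)` is the
  -- vector in their span whose inner products with them are `p`. It represents `s`, indexed by
  -- `none`.
  let x : Fin (n + 1) → ℂ := star ((pickMatrix z w)⁻¹ *ᵥ p)
  let a : Option (Fin (n + 1)) → ℂ := fun k => k.elim s z
  let c : Option (Fin (n + 1)) → ℂ := fun k => k.elim ω w
  let g : Option (Fin (n + 1)) → EuclideanSpace ℂ (Fin (n + 1)) :=
    fun k => WithLp.toLp 2 (k.elim (x ᵥ* A) A)
  have hPp : pickMatrix z w *ᵥ ((pickMatrix z w)⁻¹ *ᵥ p) = p := by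
    rw [mulVec_mulVec, Matrix.mul_nonsing_inv _ ((Matrix.isUnit_iff_isUnit_det _).1 hP.isUnit),
      one_mulVec]
  have hxA : star (x ᵥ* A) = Aᴴ *ᵥ ((pickMatrix z w)⁻¹ *ᵥ p) := by
    rw [star_vecMul, star_star]
  have g11 : ∀ k l, inner ℂ (g (some l)) (g (some k)) = pickMatrix z w k l := by
    intro k l
    rw [EuclideanSpace.inner_eq_star_dotProduct, hA]
    rfl
  have g10 : ∀ k, inner ℂ (g none) (g (some k)) = p k := by
    intro k
    rw [EuclideanSpace.inner_eq_star_dotProduct]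
    change A k ⬝ᵥ star (x ᵥ* A) = p k
    rw [hxA]
    change (A *ᵥ (Aᴴ *ᵥ ((pickMatrix z w)⁻¹ *ᵥ p))) k = p k
    rw [mulVec_mulVec, ← hA, hPp]
  have g00 : inner ℂ (g none) (g none) = innerInv (pickMatrix z w) p p := by
    rw [EuclideanSpace.inner_eq_star_dotProduct]
    change (x ᵥ* A) ⬝ᵥ star (x ᵥ* A) = _
    rw [hxA, ← dotProduct_mulVec, mulVec_mulVec, ← hA, hPp, ← star_innerInv hP, innerInv,
      ← star_dotProduct_star, star_star, dotProduct_comm]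
  have ha : ∀ k, ‖a k‖ < 1 := by rintro (_ | k) <;> simp [a, hz, hs]
  have hg : ∀ k l, (1 - a k * star (a l)) * inner ℂ (g l) (g k) = c k + star (c l) := by
    rintro (_ | k) (_ | l)
    · rw [g00, hnorm]
      simp only [a, c, Option.elim]
      field_simp
    · rw [← inner_conj_symm, g10]
      have h := congrArg star (one_sub_mul_borderVec (w := w) hz hs ω l)
      simp only [star_mul', star_sub, star_add, star_one, star_star, ← hp] at h
      simp only [a, c, Option.elim]
      rw [← Complex.star_def, mul_comm s, h, add_comm]
    · rw [g10]
      exact one_sub_mul_borderVec hz hs ω k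
    · rw [g11]
      have hkl : 1 - z k * star (z l) ≠ 0 :=
        one_sub_mul_ne_zero (hz k) (by rw [norm_star]; exact (hz l).le)
      simp only [a, c, Option.elim, pickMatrix, Matrix.of_apply]
      field_simp
  obtain ⟨θ, r, hr⟩ := exists_atoms_of_gram a c g ha hg (m := n + 1) (by simp)
  have hcross : ∀ k l, crossCovariance (atomicSpectrum θ r) (a k) (a l) = inner ℂ (g l) (g k) :=
    fun k l => by rw [crossCovariance_atomicSpectrum, hr]
  refine ⟨atomicSpectrum θ r, mem_consistentSpectra_iff.2 fun k l => ?_,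
    atomicSpectrum_singular θ r, ?_⟩
  · exact (hcross (some k) (some l)).trans (g11 k l)
  · have h := two_mul_poissonIntegral (atomicSpectrum θ r) hs
    rw [show crossCovariance (atomicSpectrum θ r) s s = _ from (hcross none none).trans g00,
      hnorm, mul_div_cancel₀ _ hne] at h
    have h4 := congrArg Complex.re h
    simp at h4
    linarith

/-- At `s = z k` and `ω = w k` the border is the `k`-th column of the Pick matrix, so the defect
vanishes. This provides a boundary point, hence a consistent spectrum, before the squared radius is
known to be nonnegative. -/
theorem discRadiusSq_node (hP : (pickMatrix z w).PosDef) (hz : ∀ k, ‖z k‖ < 1)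
    (k : Fin (n + 1)) :
    ‖w k - discCenter z w (z k)‖ ^ 2 = discRadiusSq z w (z k) := by
  have hcol : borderVec z w (z k) (w k) = pickMatrix z w *ᵥ Pi.single k 1 := by
    ext l
    apply mul_left_cancel₀ (one_sub_mul_ne_zero (hz l) (b := star (z k))
      (by rw [norm_star]; exact (hz k).le))
    rw [one_sub_mul_borderVec hz (hz k)]
    have hne : 1 - z l * star (z k) ≠ 0 :=
      one_sub_mul_ne_zero (hz l) (by rw [norm_star]; exact (hz k).le)
    simp only [mulVec_single_one, Matrix.col_apply, pickMatrix, Matrix.of_apply]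
    field_simp
  have h := innerInv_borderVec hP hz (hz k) (w k)
  have hinv : innerInv (pickMatrix z w) (borderVec z w (z k) (w k)) (borderVec z w (z k) (w k)) =
      (w k + star (w k)) / (1 - z k * star (z k)) := by
    rw [innerInv, hcol, mulVec_mulVec, Matrix.nonsing_inv_mul _
      ((Matrix.isUnit_iff_isUnit_det _).1 hP.isUnit), one_mulVec, dotProduct_single, mul_one,
      ← hcol, Pi.star_apply]
    have h1 := one_sub_mul_borderVec (w := w) hz (hz k) (w k) k
    have hne : 1 - z k * star (z k) ≠ 0 :=
      one_sub_mul_ne_zero (hz k) (by rw [norm_star]; exact (hz k).le)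
    have h2 := congrArg star h1
    simp only [star_mul', star_sub, star_add, star_one, star_star] at h2
    rw [eq_div_iff hne]
    linear_combination h2
  rw [hinv, sub_self] at h
  have hB : innerInv (pickMatrix z w) (bVec z (z k)) (bVec z (z k)) ≠ 0 := by
    intro h
    have := innerInv_self_re_pos hP (bVec_ne_zero hz (hz k))
    rw [h] at this
    exact lt_irrefl _ this
  have h3 := (mul_eq_zero.1 h.symm).resolve_left hB
  exact sub_eq_zero.1 (by exact_mod_cast h3)

theorem consistentSpectra_nonempty (hP : (pickMatrix z w).PosDef) (hz : ∀ k, ‖z k‖ < 1) :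
    (consistentSpectra z w).Nonempty := by
  obtain ⟨μ, hμ, -⟩ := exists_singular_of_boundary hP hz (hz 0) (discRadiusSq_node hP hz 0)
  exact ⟨μ, hμ⟩

/-- Some consistent spectrum exists, and its value at `s` lies in the disc, which is therefore
nonempty. -/
theorem discRadiusSq_nonneg (hP : (pickMatrix z w).PosDef) (hz : ∀ k, ‖z k‖ < 1)
    (hs : ‖s‖ < 1) : 0 ≤ discRadiusSq z w s := by
  obtain ⟨μ, hμ⟩ := consistentSpectra_nonempty hP hz
  obtain ⟨ω, -, hω⟩ := exists_mem_disc hP hz hs hμ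
  exact (sq_nonneg _).trans hω

theorem abs_poissonIntegral_sub_le (hP : (pickMatrix z w).PosDef) (hz : ∀ k, ‖z k‖ < 1)
    (hs : ‖s‖ < 1) {μ₀ μ₁ : Spectrum} (h₀ : μ₀ ∈ consistentSpectra z w)
    (h₁ : μ₁ ∈ consistentSpectra z w) :
    |poissonIntegral μ₀ s - poissonIntegral μ₁ s| ≤ pointwiseDiameter z w s := by
  obtain ⟨ω₀, hr₀, hd₀⟩ := exists_mem_disc hP hz hs h₀
  obtain ⟨ω₁, hr₁, hd₁⟩ := exists_mem_disc hP hz hs h₁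
  rw [← hr₀, ← hr₁, ← Complex.sub_re, pointwiseDiameter_eq]
  calc |(ω₀ - ω₁).re| ≤ ‖ω₀ - ω₁‖ := Complex.abs_re_le_norm _
    _ ≤ ‖ω₀ - discCenter z w s‖ + ‖ω₁ - discCenter z w s‖ := by
        rw [show ω₀ - ω₁ = (ω₀ - discCenter z w s) - (ω₁ - discCenter z w s) by ring]
        exact norm_sub_le _ _
    _ ≤ 2 * Real.sqrt (discRadiusSq z w s) := by
        linarith [Real.le_sqrt_of_sq_le hd₀, Real.le_sqrt_of_sq_le hd₁]

theorem exists_singular_pair (hP : (pickMatrix z w).PosDef) (hz : ∀ k, ‖z k‖ < 1)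
    (hs : ‖s‖ < 1) :
    ∃ μ₀ ∈ consistentSpectra z w, ∃ μ₁ ∈ consistentSpectra z w,
      |poissonIntegral μ₀ s - poissonIntegral μ₁ s| = pointwiseDiameter z w s ∧
      IsSingularWithSupportAtMost (n + 1) μ₀ ∧ IsSingularWithSupportAtMost (n + 1) μ₁ := by
  have hr := Real.sq_sqrt (discRadiusSq_nonneg hP hz hs)
  -- Only real parts are observed, so the two boundary points are taken on the horizontal diameter.
  obtain ⟨μ₀, h₀, hs₀, hv₀⟩ := exists_singular_of_boundary hP hz hs
    (ω := discCenter z w s + (Real.sqrt (discRadiusSq z w s) : ℝ)) (by simp [hr])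
  obtain ⟨μ₁, h₁, hs₁, hv₁⟩ := exists_singular_of_boundary hP hz hs
    (ω := discCenter z w s - (Real.sqrt (discRadiusSq z w s) : ℝ)) (by simp [hr])
  refine ⟨μ₀, h₀, μ₁, h₁, ?_, hs₀, hs₁⟩
  rw [hv₀, hv₁, pointwiseDiameter_eq, Complex.add_re, Complex.sub_re, Complex.ofReal_re,
    show ∀ a b : ℝ, a + b - (a - b) = 2 * b from fun a b => by ring]
  exact abs_of_nonneg (by positivity)

theorem continuousOn_pointwiseDiameter (hP : (pickMatrix z w).PosDef) (hz : ∀ k, ‖z k‖ < 1) :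
    ContinuousOn (pointwiseDiameter z w) (Metric.ball 0 1) := by
  have hden : ∀ k, ∀ s ∈ Metric.ball (0 : ℂ) 1, 1 - z k * star s ≠ 0 := fun k s hs =>
    one_sub_mul_ne_zero (hz k) (by rw [norm_star]; exact (mem_ball_zero_iff.1 hs).le)
  have hdenc : ∀ k, ContinuousOn (fun s : ℂ => 1 - z k * star s) (Metric.ball 0 1) := fun k =>
    (continuous_const.sub (continuous_const.mul continuous_star)).continuousOn
  have hb : ∀ k, ContinuousOn (fun s => bVec z s k) (Metric.ball 0 1) := fun k =>
    continuousOn_const.div (hdenc k) (hden k)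
  have hd : ∀ k, ContinuousOn (fun s => dVec z w s k) (Metric.ball 0 1) := fun k =>
    (continuousOn_const.div (hdenc k) (hden k)).neg
  have hinner : ∀ f g : ℂ → Fin (n + 1) → ℂ,
      (∀ k, ContinuousOn (fun s => f s k) (Metric.ball 0 1)) →
      (∀ k, ContinuousOn (fun s => g s k) (Metric.ball 0 1)) →
      ContinuousOn (fun s => innerInv (pickMatrix z w) (f s) (g s)) (Metric.ball 0 1) := by
    intro f g hf hg
    simp only [innerInv, dotProduct, Matrix.mulVec, Pi.star_apply]
    exact continuousOn_finsetSum _ fun k _ => (hg k).star.mul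
      (continuousOn_finsetSum _ fun l _ => continuousOn_const.mul (hf l))
  have hB : ∀ s ∈ Metric.ball (0 : ℂ) 1,
      innerInv (pickMatrix z w) (bVec z s) (bVec z s) ≠ 0 := by
    intro s hs h
    have := innerInv_self_re_pos hP (bVec_ne_zero hz (mem_ball_zero_iff.1 hs))
    rw [h] at this
    exact lt_irrefl _ this
  have hself : ContinuousOn (fun s : ℂ => 1 / (1 - s * star s)) (Metric.ball 0 1) := by
    refine continuousOn_const.div
      (continuous_const.sub (continuous_id.mul continuous_star)).continuousOn fun s hs => ?_
    have hs' := mem_ball_zero_iff.1 hs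
    exact one_sub_mul_ne_zero hs' (by rw [norm_star]; exact hs'.le)
  exact continuousOn_const.mul ((((hself.add (hinner _ _ hb hd)).div (hinner _ _ hb hb) hB).norm.pow
    2).sub (Complex.continuous_re.comp_continuousOn
      ((hinner _ _ hd hd).div (hinner _ _ hb hb) hB))).sqrt

end Disc

end FilterBank

end

/-! ### The diameter of the family of consistent spectra -/

theorem proposition17 (n : ℕ) (z w : Fin (n + 1) → ℂ) (hz : ∀ k, ‖z k‖ < 1)
    (hP : (FilterBank.pickMatrix z w).PosDef)
    (K : Set ℂ) (hKclosed : IsClosed K) (hKdisc : K ⊆ Metric.ball (0 : ℂ) 1)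
    (hKne : K.Nonempty) :
    BddAbove (FilterBank.distances (FilterBank.deltaK K) (FilterBank.consistentSpectra z w)) ∧
    IsGreatest (FilterBank.pointwiseDiameter z w '' K)
      (FilterBank.diameter (FilterBank.deltaK K) (FilterBank.consistentSpectra z w)) ∧
    ∃ μ₀ ∈ FilterBank.consistentSpectra z w, ∃ μ₁ ∈ FilterBank.consistentSpectra z w,
      FilterBank.deltaK K μ₀ μ₁ =
        FilterBank.diameter (FilterBank.deltaK K) (FilterBank.consistentSpectra z w) ∧
      FilterBank.IsSingularWithSupportAtMost (n + 1) μ₀ ∧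
      FilterBank.IsSingularWithSupportAtMost (n + 1) μ₁ := by
  have hKcompact : IsCompact K :=
    Metric.isCompact_of_isClosed_isBounded hKclosed (Metric.isBounded_ball.subset hKdisc)
  have hnorm : ∀ s ∈ K, ‖s‖ < 1 := fun s hs => mem_ball_zero_iff.1 (hKdisc hs)
  obtain ⟨s₀, hs₀, hmax⟩ := hKcompact.exists_isMaxOn hKne
    ((FilterBank.continuousOn_pointwiseDiameter hP hz).mono hKdisc)
  have hbound : ∀ μ₀ ∈ FilterBank.consistentSpectra z w,
      ∀ μ₁ ∈ FilterBank.consistentSpectra z w, ∀ s ∈ K,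
      |FilterBank.poissonIntegral μ₀ s - FilterBank.poissonIntegral μ₁ s| ≤
        FilterBank.pointwiseDiameter z w s₀ := fun μ₀ h₀ μ₁ h₁ s hs =>
    (FilterBank.abs_poissonIntegral_sub_le hP hz (hnorm s hs) h₀ h₁).trans (hmax hs)
  have hdelta : ∀ μ₀ ∈ FilterBank.consistentSpectra z w,
      ∀ μ₁ ∈ FilterBank.consistentSpectra z w,
      FilterBank.deltaK K μ₀ μ₁ ≤ FilterBank.pointwiseDiameter z w s₀ := by
    intro μ₀ h₀ μ₁ h₁
    refine csSup_le (hKne.image _) ?_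
    rintro _ ⟨s, hs, rfl⟩
    exact hbound μ₀ h₀ μ₁ h₁ s hs
  -- A pair extremal at the maximising point `s₀` is extremal for `δ_K`: its difference at `s₀`
  -- already equals the bound valid for all pairs and all of `K`.
  obtain ⟨μ₀, h₀, μ₁, h₁, heq, hsing₀, hsing₁⟩ :=
    FilterBank.exists_singular_pair hP hz (hnorm s₀ hs₀)
  have hattain : FilterBank.deltaK K μ₀ μ₁ = FilterBank.pointwiseDiameter z w s₀ := by
    refine le_antisymm (hdelta μ₀ h₀ μ₁ h₁) ?_
    rw [← heq]
    refine le_csSup ⟨FilterBank.pointwiseDiameter z w s₀, ?_⟩ ⟨s₀, hs₀, rfl⟩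
    rintro _ ⟨s, hs, rfl⟩
    exact hbound μ₀ h₀ μ₁ h₁ s hs
  have hgreatest : IsGreatest
      (FilterBank.distances (FilterBank.deltaK K) (FilterBank.consistentSpectra z w))
      (FilterBank.pointwiseDiameter z w s₀) := by
    refine ⟨⟨μ₀, h₀, μ₁, h₁, hattain.symm⟩, ?_⟩
    rintro _ ⟨ν₀, hν₀, ν₁, hν₁, rfl⟩
    exact hdelta ν₀ hν₀ ν₁ hν₁
  have hdiam : FilterBank.diameter (FilterBank.deltaK K) (FilterBank.consistentSpectra z w) =
      FilterBank.pointwiseDiameter z w s₀ := hgreatest.csSup_eq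
  rw [hdiam]
  refine ⟨hgreatest.bddAbove, ⟨⟨s₀, hs₀, rfl⟩, ?_⟩, μ₀, h₀, μ₁, h₁, hattain, hsing₀, hsing₁⟩
  rintro _ ⟨s, hs, rfl⟩
  exact hmax hs
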